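/- For integers $n\ge 1$ and $k\ge 0$ let $$h_k(a_1,\dots,a_n)=\sum_{1\le i_1\le\cdots\le i_k\le n}a_{i_1}\cdots a_{i_k}$$ be the complete homogeneous symmetric polynomial of degree $k$ (with $h_0=1$). Let $n\ge 2$ be an even integer and let $$\tilde a=\Big(\underbrace{\tfrac1{\sqrt n},\dots,\tfrac1{\sqrt n}}_{n/2},\underbrace{-\tfrac1{\sqrt n},\dots,-\tfrac1{\sqrt n}}_{n/2}\Big)$$ be the half-plus/half-minus vector. Let $a=(a_1,\dots,a_n)\in\mathbb R^n$ with $\sum_{i=1}^n a_i^2=1$. Then, for every integer $r\ge 1$, $$h_{2r}(a_1,\dots,a_n)\ \ge\ \frac{\left(\frac n2+r-1\right)!}{r!\,\left(\frac n2-1\right)!\,n^r}.$$ The inequality is sharp: $\sum_i\tilde a_i^2=1$, and equality holds whenever $a$ is a permutation of $\tilde a$. If $r\ge 2$ or $n=2$, then equality holds if and only if $a$ is a permutation of $\tilde a$. If $r=1$, then equality holds if and only if $\sum_{i=1}^n a_i=0$. -/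

import Mathlib

/-- The value at `a ∈ ℝⁿ` of the complete homogeneous symmetric polynomial of degree `k` in `n`
variables: the sum of `a_{i₁} ⋯ a_{i_k}` over all multisets `{i₁ ≤ ⋯ ≤ i_k}` of indices. -/
noncomputable def completeHomogeneous {n : ℕ} (k : ℕ) (a : Fin n → ℝ) : ℝ :=
  MvPolynomial.eval a (MvPolynomial.hsymm (Fin n) ℝ k)

/-- The half-plus/half-minus vector: the first `n / 2` coordinates are `1 / √n`, the others
are `-1 / √n` (used for even `n`). -/
noncomputable def halfVector (n : ℕ) : Fin n → ℝ :=
  fun i => if (i : ℕ) < n / 2 then 1 / Real.sqrt n else -(1 / Real.sqrt n)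

/-- The vector `a` is obtained from `b` by permuting coordinates. -/
def IsPermutationOf {n : ℕ} (a b : Fin n → ℝ) : Prop :=
  ∃ σ : Equiv.Perm (Fin n), ∀ i, a i = b (σ i)

/-- The constant `(n/2 + r - 1)! / (r! (n/2 - 1)! nʳ)`; for even `n ≥ 2` the division by two is
exact and no subtraction truncates. -/
noncomputable def hunterBound (n r : ℕ) : ℝ :=
  (Nat.factorial (n / 2 + r - 1) : ℝ) /
    ((Nat.factorial r : ℝ) * (Nat.factorial (n / 2 - 1) : ℝ) * (n : ℝ) ^ r)

/-!
Write `h_k(s)` for the complete homogeneous symmetric polynomial at a multiset `s` of reals, the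
coefficient of `t ^ k` in `∏ 1 / (1 - x t)`. For `2 N` real numbers with sum of squares `ρ > 0` the
bound reads `h_{2r}(s) ≥ c(N, r) (ρ / 2N) ^ r`, where `c(N, r) = N (N + 1) ⋯ (N + r - 1) / r!`. It
is proved for all `N` at once, by induction on `r` (`negBinomCoeff_mul_pow_le_hCoeff`).

By compactness it suffices to treat a minimiser `s` on the sphere. As `∂h_k/∂x = h_{k-1}(x, s)`, the
Lagrange condition and Euler's identity give `ρ h_{2r-1}(x, s) = 2r h_{2r}(s) x` for each element
`x` of `s`, and the divided difference of two such equations is `ρ h_{2r-2}(x, y, s) = 2r h_{2r}(s)`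
for `x ≠ y` in `s` (`IsSphereMin.lagrange_pair`). The left side is bounded below by the induction
hypothesis for the `2 N + 2` numbers `x, y, s`, and this is exactly the desired bound as soon as
`x² + y² ≥ ρ / N`, that is, as soon as adjoining `x, y` does not lower the mean square.

Such a pair exists (`IsSphereMin.exists_pair`). Otherwise, averaging shows that the value `x` of
largest modulus fills more than half of the places. Changing the sign of one copy of `x` changes
`h_{2r}` by `2 x h_{2r-1}(-x, s)`, and this is positive: each entry different from `x` can be paired
with a copy of `x`, and `1 / ((1 - x t) (1 - b t))` has nonnegative coefficients if `|b| ≤ x`. So `s`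
would not be a minimiser.

If equality holds, then `s` is a minimiser, `x² + y² = ρ / N`, and `x, y, s` is an equality case for
`r - 1`. For `r ≥ 3` the induction hypothesis finishes the proof (`balanced_of_hCoeff_eq`). For
`r = 2` it gives only that `x, y, s` sums to zero, and the Lagrange condition, through `h_1` and
`h_3`, is used once more (`balanced_of_hCoeff_four_eq`).
-/

open PowerSeries

/-! ### Complete homogeneous symmetric polynomials of a multiset -/

/-- The geometric series `1 + x t + x² t² + ⋯ = 1 / (1 - x t)`. -/
noncomputable def geomSeries (x : ℝ) : ℝ⟦X⟧ := PowerSeries.mk fun k => x ^ k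

/-- The generating series `∏ 1 / (1 - x t)` of the complete homogeneous symmetric polynomials
evaluated at the elements of `s`. -/
noncomputable def hSeries (s : Multiset ℝ) : ℝ⟦X⟧ := (s.map geomSeries).prod

/-- The complete homogeneous symmetric polynomial of degree `k` evaluated at a multiset of reals,
encoded as a coefficient of `hSeries`. -/
noncomputable def hCoeff (k : ℕ) (s : Multiset ℝ) : ℝ := coeff k (hSeries s)

/-- The sum of the squares of the elements of `s`. -/
noncomputable def sqSum (s : Multiset ℝ) : ℝ := (s.map fun x => x ^ 2).sum

@[simp] lemma sqSum_cons (x : ℝ) (s : Multiset ℝ) : sqSum (x ::ₘ s) = x ^ 2 + sqSum s := by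
  simp [sqSum]

lemma geomSeries_eq (x : ℝ) : geomSeries x = 1 + C x * X * geomSeries x := by
  ext k
  cases k with
  | zero => simp [geomSeries]
  | succ k =>
    rw [map_add, mul_assoc, coeff_C_mul, coeff_succ_X_mul]
    simp [geomSeries, coeff_one, pow_succ, mul_comm]

lemma hSeries_cons (x : ℝ) (s : Multiset ℝ) : hSeries (x ::ₘ s) = geomSeries x * hSeries s := by
  simp [hSeries]

lemma hSeries_cons_eq (x : ℝ) (s : Multiset ℝ) :
    hSeries (x ::ₘ s) = hSeries s + C x * (X * hSeries (x ::ₘ s)) := by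
  rw [hSeries_cons]
  conv_lhs => rw [geomSeries_eq]
  ring

@[simp] lemma hCoeff_zero (s : Multiset ℝ) : hCoeff 0 s = 1 := by
  induction s using Multiset.induction with
  | empty => simp [hCoeff, hSeries]
  | cons x s ih =>
    rw [hCoeff, hSeries_cons_eq, map_add]
    simpa [hCoeff] using ih

lemma hCoeff_succ_cons (k : ℕ) (x : ℝ) (s : Multiset ℝ) :
    hCoeff (k + 1) (x ::ₘ s) = hCoeff (k + 1) s + x * hCoeff k (x ::ₘ s) := by
  rw [hCoeff, hSeries_cons_eq, map_add, coeff_C_mul, coeff_succ_X_mul]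
  rfl

/-- The divided difference of `x ↦ h_{k+1}(x, s)` at `x, y` is `h_k(x, y, s)`. -/
lemma hCoeff_cons_sub_cons (k : ℕ) (x y : ℝ) (s : Multiset ℝ) :
    hCoeff (k + 1) (x ::ₘ s) - hCoeff (k + 1) (y ::ₘ s) = (x - y) * hCoeff k (x ::ₘ y ::ₘ s) := by
  have h1 := hCoeff_succ_cons k x (y ::ₘ s)
  have h2 := hCoeff_succ_cons k y (x ::ₘ s)
  rw [Multiset.cons_swap] at h2
  linear_combination h1 - h2

lemma hCoeff_map_mul (c : ℝ) (k : ℕ) (s : Multiset ℝ) :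
    hCoeff k (s.map fun x => c * x) = c ^ k * hCoeff k s := by
  have : hSeries (s.map fun x => c * x) = rescale c (hSeries s) := by
    rw [hSeries, hSeries, map_multiset_prod, Multiset.map_map, Multiset.map_map]
    congr 2
    funext x
    ext k
    simp [geomSeries, coeff_rescale, mul_pow]
  rw [hCoeff, this, coeff_rescale, hCoeff]

/-- Euler's identity for the homogeneous polynomial `h_k`, whose partial derivative in the variable
`x` is `h_{k-1}(x, s)`. -/
lemma sum_mul_hCoeff (k : ℕ) (s : Multiset ℝ) :
    (s.map fun x => x * hCoeff k (x ::ₘ s)).sum = (k + 1) * hCoeff (k + 1) s := by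
  have geom_deriv (x : ℝ) : d⁄dX ℝ (geomSeries x) = C x * geomSeries x * geomSeries x := by
    have h0 := geomSeries_eq x
    have h := congrArg (d⁄dX ℝ) h0
    simp only [map_add, Derivation.leibniz, smul_eq_mul, derivative_C, derivative_X,
      mul_zero, add_zero, mul_one, Derivation.map_one_eq_zero, zero_add] at h
    linear_combination (geomSeries x) * h - (d⁄dX ℝ (geomSeries x)) * h0
  have key : d⁄dX ℝ (hSeries s) = (s.map fun x => C x * (geomSeries x * hSeries s)).sum := by
    induction s using Multiset.induction with
    | empty => simp [hSeries]
    | cons x s ih =>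
      rw [hSeries_cons, Derivation.leibniz, smul_eq_mul, smul_eq_mul, ih, geom_deriv,
        Multiset.map_cons, Multiset.sum_cons, ← Multiset.sum_map_mul_left, add_comm]
      congr 1
      · ring
      · congr 1
        refine Multiset.map_congr rfl fun y _ => ?_
        ring
  have h := congrArg (coeff k) key
  rw [coeff_derivative, map_multiset_sum, Multiset.map_map] at h
  rw [hCoeff, mul_comm, h]
  congr 1
  refine Multiset.map_congr rfl fun y _ => ?_
  simp [hCoeff, hSeries_cons]

lemma hCoeff_one (s : Multiset ℝ) : hCoeff 1 s = s.sum := by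
  have h := sum_mul_hCoeff 0 s
  simpa using h.symm

lemma two_mul_hCoeff_two (s : Multiset ℝ) : 2 * hCoeff 2 s = s.sum ^ 2 + sqSum s := by
  have h := sum_mul_hCoeff 1 s
  simp only [hCoeff_one, Multiset.sum_cons] at h
  norm_num at h
  have e : (s.map fun x => x * (x + s.sum)) = s.map fun x => x * s.sum + x ^ 2 :=
    Multiset.map_congr rfl fun y _ => by ring
  rw [← h, e, Multiset.sum_map_add, Multiset.sum_map_mul_right, Multiset.map_id', sqSum, sq s.sum]

lemma three_mul_hCoeff_three {s : Multiset ℝ} (hs : s.sum = 0) :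
    3 * hCoeff 3 s = (s.map fun x => x ^ 3).sum := by
  have h := sum_mul_hCoeff 2 s
  norm_num at h
  rw [← h]
  have h2 : ∀ x : ℝ, x * hCoeff 2 (x ::ₘ s) = x ^ 3 + x * (sqSum s / 2) := fun x => by
    have := two_mul_hCoeff_two (x ::ₘ s)
    rw [Multiset.sum_cons, hs, sqSum_cons] at this
    linear_combination x / 2 * this
  simp only [h2]
  rw [Multiset.sum_map_add, Multiset.sum_map_mul_right, Multiset.map_id', hs]
  simp

/-- Expanding `∏ 1 / (1 - a i t)`, the exponent vectors of total degree `k` are the multiplicity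
vectors of the multisets of `k` indices. -/
lemma completeHomogeneous_eq_hCoeff {n : ℕ} (k : ℕ) (a : Fin n → ℝ) :
    completeHomogeneous k a = hCoeff k (Finset.univ.val.map a) := by
  classical
  have h : hSeries (Finset.univ.val.map a) = ∏ i, geomSeries (a i) := by
    rw [hSeries, Multiset.map_map]; rfl
  rw [hCoeff, h, PowerSeries.coeff_prod, completeHomogeneous, MvPolynomial.hsymm, map_sum]
  refine Finset.sum_bij (fun s _ => Multiset.toFinsupp (s : Multiset (Fin n))) ?_ ?_ ?_ ?_
  · intro s _
    simp only [Finset.mem_finsuppAntidiag, Finset.subset_univ, and_true]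
    change ∑ i, Multiset.count i (s : Multiset (Fin n)) = k
    exact (Multiset.sum_count_eq_card fun i _ => Finset.mem_univ i).trans s.2
  · intro s _ t _ hst
    exact Subtype.ext (Multiset.toFinsupp.injective hst)
  · intro f hf
    rw [Finset.mem_finsuppAntidiag] at hf
    refine ⟨⟨Finsupp.toMultiset f, ?_⟩, Finset.mem_univ _, Finsupp.toMultiset_toFinsupp f⟩
    rw [Finsupp.card_toMultiset, Finsupp.sum_fintype _ _ (by simp)]
    exact hf.1
  · intro s _
    rw [map_multiset_prod, Multiset.map_map, Finset.prod_multiset_map_count]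
    simp only [geomSeries, coeff_mk, Multiset.toFinsupp_apply, Function.comp, MvPolynomial.eval_X]
    refine Finset.prod_subset (Finset.subset_univ _) fun i _ hi => ?_
    rw [Multiset.mem_toFinset] at hi
    rw [Multiset.count_eq_zero.2 hi, pow_zero]

/-! ### Positivity when one value dominates -/

/-- All coefficients of `1 / ((1 - x t) (1 - b t))` are nonnegative when `|b| ≤ x`. -/
lemma coeff_geomSeries_mul_nonneg {x b : ℝ} (hb : |b| ≤ x) :
    ∀ k : ℕ, 0 ≤ coeff k (geomSeries b * geomSeries x)
  | 0 => by simp [geomSeries]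
  | 1 => by
    have := hCoeff_one {b, x}
    simp only [hCoeff, hSeries, Multiset.insert_eq_cons, Multiset.map_cons, Multiset.prod_cons,
      Multiset.map_singleton, Multiset.prod_singleton, Multiset.sum_cons,
      Multiset.sum_singleton] at this
    rw [this]
    linarith [neg_abs_le b]
  | k + 2 => by
    have e (j : ℕ) : coeff (j + 1) (geomSeries b * geomSeries x)
        = x ^ (j + 1) + b * coeff j (geomSeries b * geomSeries x) := by
      have := hCoeff_succ_cons j b {x}
      simpa [hCoeff, hSeries, geomSeries] using this
    have hx : 0 ≤ x := (abs_nonneg b).trans hb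
    have h0 := coeff_geomSeries_mul_nonneg hb k
    rw [e, e]
    have h1 : 0 ≤ x ^ (k + 1) * (x + b) :=
      mul_nonneg (pow_nonneg hx _) (by linarith [neg_abs_le b])
    have h2 := mul_nonneg (sq_nonneg b) h0
    linear_combination h1 + h2

/-- If some `x > 0` occurs in a multiset more often than all the other, not larger in absolute
value, elements together, then every `h_k` is positive: pair each of the others with a copy of
`x`. -/
lemma hCoeff_pos_of_pos {x : ℝ} (hx : 0 < x) (t : Multiset ℝ) :
    ∀ m : ℕ, t.card < m → (∀ b ∈ t, |b| ≤ x) →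
      ∀ k, 0 < hCoeff k (t + Multiset.replicate m x) := by
  induction t using Multiset.induction with
  | empty =>
    intro m hm _ k
    obtain ⟨m, rfl⟩ : ∃ j, m = j + 1 := ⟨m - 1, by simp at hm; omega⟩
    clear hm
    rw [zero_add]
    induction m generalizing k with
    | zero => simp [hCoeff, hSeries, geomSeries, pow_pos hx]
    | succ m ih =>
      rw [Multiset.replicate_succ]
      induction k with
      | zero => simp
      | succ k ihk =>
        rw [hCoeff_succ_cons]
        exact add_pos (ih _) (mul_pos hx ihk)
  | cons b t ih =>
    intro m hm hb k
    obtain ⟨m, rfl⟩ : ∃ j, m = j + 1 := ⟨m - 1, by simp at hm; omega⟩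
    have ih' := ih m (by simpa using hm) fun c hc => hb c (Multiset.mem_cons_of_mem hc)
    have e : hSeries (b ::ₘ t + Multiset.replicate (m + 1) x)
        = (geomSeries b * geomSeries x) * hSeries (t + Multiset.replicate m x) := by
      rw [Multiset.replicate_succ, Multiset.cons_add, Multiset.add_cons, hSeries_cons,
        hSeries_cons, mul_assoc]
    rw [hCoeff, e, coeff_mul]
    refine Finset.sum_pos' (fun p _ => mul_nonneg
      (coeff_geomSeries_mul_nonneg (hb b (Multiset.mem_cons_self b t)) _) (ih' _).le)
      ⟨(0, k), by simp, ?_⟩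
    simpa [geomSeries, hCoeff] using ih' k

/-- The version of `hCoeff_pos_of_pos` for `x` of either sign, obtained by scaling with `x`. -/
lemma pow_mul_hCoeff_pos {x : ℝ} (hx : x ≠ 0) {t : Multiset ℝ} {m : ℕ} (hm : t.card < m)
    (ht : ∀ b ∈ t, |b| ≤ |x|) (k : ℕ) :
    0 < x ^ k * hCoeff k (t + Multiset.replicate m x) := by
  rw [← hCoeff_map_mul, Multiset.map_add, Multiset.map_replicate]
  refine hCoeff_pos_of_pos (mul_self_pos.2 hx) _ m (by simpa using hm) ?_ k
  intro c hc
  obtain ⟨b, hb, rfl⟩ := Multiset.mem_map.1 hc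
  rw [abs_mul, ← abs_mul_abs_self x]
  exact mul_le_mul_of_nonneg_left (ht b hb) (abs_nonneg x)

/-! ### Derivatives -/

lemma hasDerivAt_hCoeff_cons {u : ℝ → ℝ} {u' θ : ℝ} (hu : HasDerivAt u u' θ) (s : Multiset ℝ) :
    ∀ k : ℕ, HasDerivAt (fun τ => hCoeff (k + 1) (u τ ::ₘ s))
      (u' * hCoeff k (u θ ::ₘ u θ ::ₘ s)) θ
  | 0 => by simpa [hCoeff_one] using hu
  | k + 1 => by
    have ih := hasDerivAt_hCoeff_cons hu s k
    simp only [fun τ => hCoeff_succ_cons (k + 1) (u τ) s]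
    refine ((hu.mul ih).const_add _).congr_deriv ?_
    rw [hCoeff_succ_cons k (u θ) (u θ ::ₘ s)]
    ring

lemma hasDerivAt_hCoeff_cons_cons {u v : ℝ → ℝ} {u' v' θ : ℝ} (hu : HasDerivAt u u' θ)
    (hv : HasDerivAt v v' θ) (s : Multiset ℝ) :
    ∀ k : ℕ, HasDerivAt (fun τ => hCoeff (k + 1) (u τ ::ₘ v τ ::ₘ s))
      (u' * hCoeff k (u θ ::ₘ u θ ::ₘ v θ ::ₘ s) + v' * hCoeff k (v θ ::ₘ u θ ::ₘ v θ ::ₘ s)) θ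
  | 0 => by
    simp only [zero_add, hCoeff_one, Multiset.sum_cons, hCoeff_zero, mul_one, ← add_assoc]
    exact (hu.add hv).add_const _
  | k + 1 => by
    have ih := hasDerivAt_hCoeff_cons_cons hu hv s k
    simp only [fun τ => hCoeff_succ_cons (k + 1) (u τ) (v τ ::ₘ s)]
    refine ((hasDerivAt_hCoeff_cons hv s (k + 1)).add (hu.mul ih)).congr_deriv ?_
    rw [hCoeff_succ_cons k (u θ) (u θ ::ₘ v θ ::ₘ s),
      Multiset.cons_swap (v θ) (u θ) (v θ ::ₘ s), hCoeff_succ_cons k (u θ) (v θ ::ₘ v θ ::ₘ s)]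
    ring

/-! ### Minimisers on a sphere -/

/-- The multiset `s` minimises `h_k` among the multisets of the same size and the same sum of
squares. -/
def IsSphereMin (k : ℕ) (s : Multiset ℝ) : Prop :=
  ∀ t : Multiset ℝ, t.card = s.card → sqSum t = sqSum s → hCoeff k s ≤ hCoeff k t

lemma exists_isSphereMin (k : ℕ) (s : Multiset ℝ) :
    ∃ t : Multiset ℝ, t.card = s.card ∧ sqSum t = sqSum s ∧ IsSphereMin k t := by
  have lift (t : Multiset ℝ) (ht : t.card = s.card) :
      ∃ a : Fin s.card → ℝ, Finset.univ.val.map a = t := by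
    rw [← ht, ← Multiset.length_toList]
    exact ⟨t.toList.get, by rw [Fin.univ_val_map, List.ofFn_get, Multiset.coe_toList]⟩
  have sq (a : Fin s.card → ℝ) : sqSum (Finset.univ.val.map a) = ∑ i, a i ^ 2 := by
    rw [sqSum, Multiset.map_map]; rfl
  let S : Set (Fin s.card → ℝ) := {a | ∑ i, a i ^ 2 = sqSum s}
  have hcl : IsClosed S := isClosed_eq (by fun_prop) continuous_const
  have hsub : S ⊆ Set.Icc (fun _ => -√(sqSum s)) (fun _ => √(sqSum s)) := by
    intro a ha
    have hi (i) : |a i| ≤ √(sqSum s) := by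
      refine Real.abs_le_sqrt ?_
      rw [← show ∑ i, a i ^ 2 = sqSum s from ha]
      exact Finset.single_le_sum (f := fun i => a i ^ 2) (fun j _ => sq_nonneg (a j))
        (Finset.mem_univ i)
    exact ⟨fun i => (abs_le.1 (hi i)).1, fun i => (abs_le.1 (hi i)).2⟩
  have hco : IsCompact S := isCompact_Icc.of_isClosed_subset hcl hsub
  have hne : S.Nonempty := by
    obtain ⟨a, ha⟩ := lift s rfl
    exact ⟨a, by rw [Set.mem_ofPred_eq, ← sq, ha]⟩
  have hcont : Continuous fun a : Fin s.card → ℝ => completeHomogeneous k a :=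
    MvPolynomial.continuous_eval _
  obtain ⟨a, ha, hmin⟩ := hco.exists_isMinOn hne hcont.continuousOn
  refine ⟨Finset.univ.val.map a, by simp, by rw [sq]; exact ha, fun t ht ht2 => ?_⟩
  obtain ⟨b, rfl⟩ := lift t (by rw [ht]; simp)
  rw [← completeHomogeneous_eq_hCoeff, ← completeHomogeneous_eq_hCoeff]
  refine hmin ?_
  rw [Set.mem_ofPred_eq, ← sq, ht2, sq]
  exact ha

namespace IsSphereMin

/-- Stationarity under rotating two coordinates into each other. -/
lemma rotate {k : ℕ} {s : Multiset ℝ} (h : IsSphereMin (k + 1) s) {x y : ℝ} (hx : x ∈ s)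
    (hy : y ∈ s) : y * hCoeff k (x ::ₘ s) = x * hCoeff k (y ::ₘ s) := by
  rcases eq_or_ne x y with rfl | hxy
  · rfl
  obtain ⟨s, rfl⟩ := Multiset.exists_cons_of_mem hx
  obtain ⟨s, rfl⟩ := Multiset.exists_cons_of_mem ((Multiset.mem_cons.1 hy).resolve_left hxy.symm)
  -- the rotated pair has the same sum of squares, so `θ = 0` is a minimum along this curve
  let u : ℝ → ℝ := fun θ => x * Real.cos θ - y * Real.sin θ
  let v : ℝ → ℝ := fun θ => y * Real.cos θ + x * Real.sin θ
  have hu : HasDerivAt u (-y) 0 := by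
    refine (((Real.hasDerivAt_cos 0).const_mul x).sub
      ((Real.hasDerivAt_sin 0).const_mul y)).congr_deriv ?_
    simp
  have hv : HasDerivAt v x 0 := by
    refine (((Real.hasDerivAt_cos 0).const_mul y).add
      ((Real.hasDerivAt_sin 0).const_mul x)).congr_deriv ?_
    simp
  have hu0 : u 0 = x := by simp [u]
  have hv0 : v 0 = y := by simp [v]
  have hd := hasDerivAt_hCoeff_cons_cons hu hv s k
  have hloc : IsLocalMin (fun θ => hCoeff (k + 1) (u θ ::ₘ v θ ::ₘ s)) 0 := by
    refine Filter.Eventually.of_forall fun θ => ?_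
    simp only [hu0, hv0]
    refine h _ (by simp) ?_
    simp only [sqSum_cons, u, v]
    linear_combination (x ^ 2 + y ^ 2) * Real.sin_sq_add_cos_sq θ
  have := hloc.hasDerivAt_eq_zero hd
  rw [hu0, hv0] at this
  linear_combination -this

/-- The Lagrange condition: the gradient of `h_k` is `k h_k / ρ` times the point, where `ρ` is the
squared radius of the sphere; the multiplier is found by Euler's identity. -/
lemma lagrange {k : ℕ} {s : Multiset ℝ} (h : IsSphereMin (k + 1) s) {x : ℝ} (hx : x ∈ s) :
    sqSum s * hCoeff k (x ::ₘ s) = (k + 1) * hCoeff (k + 1) s * x := by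
  rw [← sum_mul_hCoeff, sqSum, ← Multiset.sum_map_mul_right, ← Multiset.sum_map_mul_right]
  congr 1
  refine Multiset.map_congr rfl fun y hy => ?_
  linear_combination y * h.rotate hx hy

/-- The divided difference of the Lagrange conditions at two different values. -/
lemma lagrange_pair {k : ℕ} {s : Multiset ℝ} (h : IsSphereMin (k + 2) s) {x y : ℝ} (hx : x ∈ s)
    (hy : y ∈ s) (hxy : x ≠ y) :
    sqSum s * hCoeff k (x ::ₘ y ::ₘ s) = (k + 2) * hCoeff (k + 2) s := by
  have h1 := h.lagrange hx
  have h2 := h.lagrange hy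
  have h3 := hCoeff_cons_sub_cons k x y s
  push_cast at h1 h2
  refine mul_left_cancel₀ (sub_ne_zero.2 hxy) ?_
  linear_combination h1 - h2 - sqSum s * h3

end IsSphereMin

/-! ### A pair of values with large squares -/

lemma sqSum_add (s t : Multiset ℝ) : sqSum (s + t) = sqSum s + sqSum t := by
  simp [sqSum]

lemma sqSum_replicate (m : ℕ) (x : ℝ) : sqSum (Multiset.replicate m x) = m * x ^ 2 := by
  simp [sqSum]

lemma sqSum_lt_card_mul {t : Multiset ℝ} {c : ℝ} (h : ∀ b ∈ t, b ^ 2 < c) (ht : t ≠ 0) :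
    sqSum t < t.card * c := by
  have := Multiset.sum_lt_sum_of_nonempty (s := t) (f := fun b => b ^ 2) (g := fun _ => c) ht h
  simpa [sqSum] using this

lemma sqSum_le_card_mul {t : Multiset ℝ} {c : ℝ} (h : ∀ b ∈ t, b ^ 2 ≤ c) :
    sqSum t ≤ t.card * c := by
  have := Multiset.sum_map_le_sum_map (s := t) (fun b => b ^ 2) (fun _ => c) h
  simpa [sqSum] using this

/-- At a minimiser of `h_{2r}` two different values have squares that add up to at least twice the
mean square. Otherwise the value `x` of largest modulus would occur in more than half of the
places, and changing the sign of one of its copies would decrease `h_{2r}`. -/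
lemma IsSphereMin.exists_pair {r N : ℕ} {s : Multiset ℝ} (h : IsSphereMin (2 * r + 2) s)
    (hN : 0 < N) (hs : s.card = 2 * N) (hpos : 0 < sqSum s) :
    ∃ x ∈ s, ∃ y ∈ s, x ≠ y ∧ sqSum s / N ≤ x ^ 2 + y ^ 2 := by
  classical
  by_contra! hcon
  have hN' : (0 : ℝ) < N := Nat.cast_pos.2 hN
  have hs0 : s.toFinset.Nonempty := by
    rw [Multiset.toFinset_nonempty]
    rintro rfl
    simp at hs
    omega
  obtain ⟨x, hx, hmax⟩ := s.toFinset.exists_max_image (fun y => |y|) hs0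
  simp only [Multiset.mem_toFinset] at hx hmax
  obtain ⟨m, t, hst, htx⟩ : ∃ m t, s = t + Multiset.replicate m x ∧ ∀ b ∈ t, b ∈ s ∧ b ≠ x := by
    refine ⟨s.count x, s.filter (· ≠ x), ?_, fun b hb => by simpa using hb⟩
    rw [← Multiset.filter_eq', add_comm]
    exact (Multiset.filter_add_not _ s).symm
  have hcard : t.card + m = 2 * N := by rw [← hs, hst]; simp
  have hcard' : (t.card : ℝ) + m = 2 * N := by exact_mod_cast hcard
  have hsq : sqSum s = sqSum t + m * x ^ 2 := by rw [hst, sqSum_add, sqSum_replicate]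
  have hmean : sqSum s ≤ 2 * N * x ^ 2 := by
    have := sqSum_le_card_mul (t := s) (c := x ^ 2) fun b hb => sq_le_sq.2 (hmax b hb)
    rw [hs] at this
    exact_mod_cast this
  have hx0 : x ≠ 0 := by
    rintro rfl
    norm_num at hmean
    linarith
  -- averaging: if `x` filled at most half of the places, the others, with squares below
  -- `sqSum s / N - x ^ 2`, could not make up the sum of squares
  have hm : N < m := by
    by_contra! hmN
    have ht0 : t ≠ 0 := by
      rintro rfl
      simp at hcard
      omega
    have h1 := sqSum_lt_card_mul (t := t) (c := sqSum s / N - x ^ 2) (fun b hb => by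
      have := hcon x hx b (htx b hb).1 (htx b hb).2.symm
      linarith) ht0
    have h2 : N * (sqSum s / N) = sqSum s := by field_simp
    have h3 : (m : ℝ) ≤ N := by exact_mod_cast hmN
    have h4 : sqSum s / N ≤ 2 * x ^ 2 := by
      rw [div_le_iff₀ hN']; linarith
    have h5 : (t.card : ℝ) = 2 * N - m := by linarith
    rw [h5] at h1
    nlinarith [mul_nonneg (sub_nonneg.2 h3) (sub_nonneg.2 h4)]
  obtain ⟨j, rfl⟩ : ∃ j, m = j + 1 := ⟨m - 1, by omega⟩
  -- minimality, compared with the multiset in which one copy of `x` has become `-x`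
  have hflip := h (-x ::ₘ (t + Multiset.replicate j x)) (by simp [hst]) (by
    rw [hsq, sqSum_cons, sqSum_add, sqSum_replicate]; push_cast; ring)
  have hs' : s = x ::ₘ (t + Multiset.replicate j x) := by
    rw [hst, Multiset.replicate_succ, Multiset.add_cons]
  have hdiff := hCoeff_cons_sub_cons (2 * r + 1) x (-x) (t + Multiset.replicate j x)
  rw [← hs'] at hdiff
  -- the divided difference `h_{2r+1}(x, -x, …)` has the sign of `x`
  have hpos := pow_mul_hCoeff_pos hx0 (t := -x ::ₘ t) (m := j + 1) (by simp; omega) (by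
    intro b hb
    rcases Multiset.mem_cons.1 hb with rfl | hb
    · simp
    · exact hmax b (htx b hb).1) (2 * r + 1)
  have e : -x ::ₘ t + Multiset.replicate (j + 1) x
      = x ::ₘ -x ::ₘ (t + Multiset.replicate j x) := by
    rw [Multiset.replicate_succ, Multiset.add_cons, Multiset.cons_add]
  rw [e, pow_succ, mul_assoc, pow_mul] at hpos
  have := pos_of_mul_pos_right hpos (by positivity)
  linarith

/-! ### The value at the balanced vector -/

/-- The coefficient `N (N + 1) ⋯ (N + r - 1) / r!` of `t ^ r` in `(1 - t) ^ (-N)`. -/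
noncomputable def negBinomCoeff (N r : ℕ) : ℝ := (N.ascFactorial r : ℝ) / (r.factorial : ℝ)

lemma succ_mul_negBinomCoeff (N r : ℕ) :
    ((r : ℝ) + 1) * negBinomCoeff N (r + 1) = N * negBinomCoeff (N + 1) r := by
  have h : N.ascFactorial (r + 1) = N * (N + 1).ascFactorial r := by
    rw [Nat.ascFactorial_succ, Nat.succ_ascFactorial]
  have hr : (r.factorial : ℝ) ≠ 0 := Nat.cast_ne_zero.2 r.factorial_ne_zero
  rw [negBinomCoeff, negBinomCoeff, h, Nat.factorial_succ]
  push_cast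
  field_simp

lemma negBinomCoeff_pos {N : ℕ} (hN : 0 < N) (r : ℕ) : 0 < negBinomCoeff N r := by
  obtain ⟨N, rfl⟩ := Nat.exists_eq_succ_of_ne_zero hN.ne'
  exact div_pos (Nat.cast_pos.2 (Nat.ascFactorial_pos N r)) (Nat.cast_pos.2 r.factorial_pos)

/-- The value of `h_{2r}` at the balanced vector; Euler's identity reduces it to `h_{2r-2}` at the
balanced vector with two more entries. -/
lemma hCoeff_balanced (x : ℝ) (r : ℕ) : ∀ N : ℕ,
    hCoeff (2 * r) (Multiset.replicate N x + Multiset.replicate N (-x))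
      = negBinomCoeff N r * (x ^ 2) ^ r := by
  induction r with
  | zero => simp [negBinomCoeff]
  | succ r ih =>
    intro N
    have h1 := sum_mul_hCoeff (2 * r + 1) (Multiset.replicate N x + Multiset.replicate N (-x))
    have h2 := hCoeff_cons_sub_cons (2 * r) x (-x)
      (Multiset.replicate N x + Multiset.replicate N (-x))
    have e : x ::ₘ -x ::ₘ (Multiset.replicate N x + Multiset.replicate N (-x))
        = Multiset.replicate (N + 1) x + Multiset.replicate (N + 1) (-x) := by
      rw [Multiset.replicate_succ, Multiset.replicate_succ, Multiset.cons_add, Multiset.add_cons]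
    rw [e, ih] at h2
    rw [Multiset.map_add, Multiset.sum_add, Multiset.map_replicate, Multiset.map_replicate,
      Multiset.sum_replicate, Multiset.sum_replicate, nsmul_eq_mul, nsmul_eq_mul] at h1
    have h3 := succ_mul_negBinomCoeff N r
    push_cast at h1
    have h0 : (2 * (r : ℝ) + 2) ≠ 0 := by positivity
    refine mul_left_cancel₀ h0 ?_
    rw [show 2 * (r + 1) = 2 * r + 1 + 1 from rfl, pow_succ]
    linear_combination -h1 + N * x * h2 - 2 * (x ^ 2) ^ r * x ^ 2 * h3

/-! ### The lower bound -/

/-- The scaling of the induction step: adjoining `x, y` with `x² + y²` at least twice the mean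
square does not lower the mean square. -/
lemma mean_sq_le {ρ N w : ℝ} (hN : 0 < N) (hw : ρ / N ≤ w) :
    ρ / (2 * N) ≤ (ρ + w) / (2 * (N + 1)) := by
  rw [div_le_iff₀ hN] at hw
  rw [div_le_div_iff₀ (by positivity) (by positivity)]
  linarith

theorem negBinomCoeff_mul_pow_le_hCoeff (r : ℕ) : ∀ (N : ℕ) (s : Multiset ℝ), 0 < N →
    s.card = 2 * N → 0 < sqSum s →
      negBinomCoeff N r * (sqSum s / (2 * N)) ^ r ≤ hCoeff (2 * r) s := by
  induction r with
  | zero => intro N s _ _ _; simp [negBinomCoeff]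
  | succ r ih =>
    intro N s₀ hN hs₀ hpos₀
    obtain ⟨s, hcard, hsq, hmin⟩ := exists_isSphereMin (2 * (r + 1)) s₀
    refine le_trans ?_ (hmin s₀ hcard.symm hsq.symm)
    rw [← hsq] at hpos₀ ⊢
    rw [← hcard] at hs₀
    clear hsq hcard
    obtain ⟨x, hx, y, hy, hxy, hw⟩ := IsSphereMin.exists_pair (r := r) hmin hN hs₀ hpos₀
    have hN' : (0 : ℝ) < N := Nat.cast_pos.2 hN
    have hpair := IsSphereMin.lagrange_pair (k := 2 * r) hmin hx hy hxy
    have hM := ih (N + 1) (x ::ₘ y ::ₘ s) (by omega) (by simp [hs₀]; ring)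
      (by rw [sqSum_cons, sqSum_cons]; positivity)
    have hq : (sqSum s / (2 * N)) ^ r
        ≤ (sqSum (x ::ₘ y ::ₘ s) / (2 * ((N + 1 : ℕ) : ℝ))) ^ r := by
      refine pow_le_pow_left₀ (by positivity) ?_ r
      rw [sqSum_cons, sqSum_cons, ← add_assoc, add_comm]
      push_cast
      exact mean_sq_le hN' hw
    have hM' := (mul_le_mul_of_nonneg_left hq (negBinomCoeff_pos (by omega : 0 < N + 1) r).le).trans
      hM
    have h3 := succ_mul_negBinomCoeff N r
    have h4 : 2 * N * (sqSum s / (2 * N)) = sqSum s := by field_simp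
    have h5 := mul_le_mul_of_nonneg_left hM' hpos₀.le
    rw [hpair] at h5
    push_cast at h5
    refine le_of_mul_le_mul_left ?_ (by positivity : (0 : ℝ) < 2 * r + 2)
    refine le_trans (le_of_eq ?_) h5
    rw [pow_succ]
    linear_combination 2 * (sqSum s / (2 * N)) ^ r * (sqSum s / (2 * N)) * h3
      + negBinomCoeff (N + 1) r * (sqSum s / (2 * N)) ^ r * h4

/-! ### The equality case -/

lemma isSphereMin_of_hCoeff_eq {r N : ℕ} {s : Multiset ℝ} (hN : 0 < N) (hs : s.card = 2 * N)
    (hpos : 0 < sqSum s)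
    (heq : hCoeff (2 * r) s = negBinomCoeff N r * (sqSum s / (2 * N)) ^ r) :
    IsSphereMin (2 * r) s := fun t ht1 ht2 => by
  rw [heq, ← ht2]
  exact negBinomCoeff_mul_pow_le_hCoeff r N t hN (ht1.trans hs) (ht2 ▸ hpos)

/-- At an equality case every inequality of the induction step is an equality. -/
lemma exists_pair_of_hCoeff_eq {r N : ℕ} (hr : 0 < r) {s : Multiset ℝ} (hN : 0 < N)
    (hs : s.card = 2 * N) (hpos : 0 < sqSum s)
    (heq : hCoeff (2 * (r + 1)) s = negBinomCoeff N (r + 1) * (sqSum s / (2 * N)) ^ (r + 1)) :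
    ∃ x ∈ s, ∃ y ∈ s, x ≠ y ∧ x ^ 2 + y ^ 2 = sqSum s / N ∧
      hCoeff (2 * r) (x ::ₘ y ::ₘ s) = negBinomCoeff (N + 1) r *
        (sqSum (x ::ₘ y ::ₘ s) / (2 * ((N + 1 : ℕ) : ℝ))) ^ r := by
  have hmin := isSphereMin_of_hCoeff_eq hN hs hpos heq
  obtain ⟨x, hx, y, hy, hxy, hw⟩ := IsSphereMin.exists_pair (r := r) hmin hN hs hpos
  have hN' : (0 : ℝ) < N := Nat.cast_pos.2 hN
  have hpair := IsSphereMin.lagrange_pair (k := 2 * r) hmin hx hy hxy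
  have hM := negBinomCoeff_mul_pow_le_hCoeff r (N + 1) (x ::ₘ y ::ₘ s) (by omega)
    (by simp [hs]; ring) (by rw [sqSum_cons, sqSum_cons]; positivity)
  have hc := negBinomCoeff_pos (by omega : 0 < N + 1) r
  have hle : sqSum s / (2 * N) ≤ sqSum (x ::ₘ y ::ₘ s) / (2 * ((N + 1 : ℕ) : ℝ)) := by
    rw [sqSum_cons, sqSum_cons, ← add_assoc, add_comm (x ^ 2 + y ^ 2)]
    push_cast
    exact mean_sq_le hN' hw
  have hM2 : hCoeff (2 * r) (x ::ₘ y ::ₘ s)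
      = negBinomCoeff (N + 1) r * (sqSum s / (2 * N)) ^ r := by
    refine mul_left_cancel₀ hpos.ne' ?_
    have h3 := succ_mul_negBinomCoeff N r
    have h4 : 2 * N * (sqSum s / (2 * N)) = sqSum s := by field_simp
    rw [hpair, show 2 * r + 2 = 2 * (r + 1) from rfl, heq, pow_succ]
    push_cast
    linear_combination 2 * (sqSum s / (2 * N)) ^ r * (sqSum s / (2 * N)) * h3
      + negBinomCoeff (N + 1) r * (sqSum s / (2 * N)) ^ r * h4
  have hq : sqSum s / (2 * N) = sqSum (x ::ₘ y ::ₘ s) / (2 * ((N + 1 : ℕ) : ℝ)) := by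
    refine le_antisymm hle (le_of_pow_le_pow_left₀ hr.ne' (by positivity) ?_)
    rw [hM2] at hM
    exact le_of_mul_le_mul_left hM hc
  refine ⟨x, hx, y, hy, hxy, ?_, by rw [hM2, hq]⟩
  rw [sqSum_cons, sqSum_cons] at hq
  push_cast at hq
  rw [div_eq_div_iff (by positivity) (by positivity)] at hq
  rw [eq_div_iff hN'.ne']
  linarith

/-- Uniqueness for `r = 2`. The pair `x, y` satisfies `x + y + ∑ s = 0`, and a third value would
have to be zero, so all elements of `x, y, s` are roots of `v (v - x) (v - y)`. Summing this cubic
and comparing with `h_3(x, y, s)` forces `x + y = 0`. -/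
lemma balanced_of_hCoeff_four_eq {N : ℕ} {s : Multiset ℝ} (hN : 0 < N) (hs : s.card = 2 * N)
    (hpos : 0 < sqSum s)
    (heq : hCoeff 4 s = negBinomCoeff N 2 * (sqSum s / (2 * N)) ^ 2) :
    (∀ v ∈ s, v ^ 2 = sqSum s / (2 * N)) ∧ s.sum = 0 := by
  have hN' : (0 : ℝ) < N := Nat.cast_pos.2 hN
  have hmin : IsSphereMin 4 s := isSphereMin_of_hCoeff_eq (r := 2) hN hs hpos heq
  obtain ⟨x, hx, y, hy, hxy, hw, hM⟩ :=
    exists_pair_of_hCoeff_eq (r := 1) one_pos hN hs hpos heq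
  have hsum : (x ::ₘ y ::ₘ s).sum = 0 := by
    have h2 := two_mul_hCoeff_two (x ::ₘ y ::ₘ s)
    have hc : negBinomCoeff (N + 1) 1 = N + 1 := by
      simp [negBinomCoeff, Nat.ascFactorial_succ]
    rw [mul_one] at hM
    rw [hM, hc, pow_one] at h2
    push_cast at h2
    have h3 : 2 * (((N : ℝ) + 1) * (sqSum (x ::ₘ y ::ₘ s) / (2 * (N + 1))))
        = sqSum (x ::ₘ y ::ₘ s) := by
      field_simp
    rw [h3] at h2
    exact pow_eq_zero_iff two_ne_zero |>.1 (by linarith)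
  have hthird : ∀ z ∈ s, z ≠ x → z ≠ y → z = 0 := by
    intro z hz hzx hzy
    -- the divided difference of the pair conditions for `x, y` and `z, y` is `h_1(x, y, z, s) = 0`
    have h1 := hmin.lagrange_pair (k := 2) hx hy hxy
    have h2 := hmin.lagrange_pair (k := 2) hz hy hzy
    have h3 := hCoeff_cons_sub_cons 1 x z (y ::ₘ s)
    have h4 : (x - z) * (sqSum s * hCoeff 1 (x ::ₘ z ::ₘ y ::ₘ s)) = 0 := by
      linear_combination h1 - h2 - sqSum s * h3
    have h5 := (mul_eq_zero.1 ((mul_eq_zero.1 h4).resolve_left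
      (sub_ne_zero.2 hzx.symm))).resolve_left hpos.ne'
    rw [hCoeff_one, Multiset.cons_swap, Multiset.sum_cons, hsum] at h5
    simpa using h5
  have hroot : ∀ v ∈ x ::ₘ y ::ₘ s, v ^ 3 = (x + y) * v ^ 2 - x * y * v := by
    intro v hv
    have h0 : v = x ∨ v = y ∨ v = 0 := by
      by_cases h1 : v = x
      · exact Or.inl h1
      by_cases h2 : v = y
      · exact Or.inr (Or.inl h2)
      simp only [Multiset.mem_cons, h1, h2, false_or] at hv
      exact Or.inr (Or.inr (hthird v hv h1 h2))
    rcases h0 with rfl | rfl | rfl <;> ring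
  have hcube : ((x ::ₘ y ::ₘ s).map fun v => v ^ 3).sum
      = (x + y) * sqSum (x ::ₘ y ::ₘ s) := by
    rw [Multiset.map_congr rfl hroot, Multiset.sum_map_sub, Multiset.sum_map_mul_left,
      Multiset.sum_map_mul_left, Multiset.map_id', hsum, mul_zero, sub_zero, sqSum]
  -- the cubic gives `3 h_3 = (x + y) p₂`, the Lagrange conditions `3 h_3 = 3 / 2 (x + y) p₂`, where
  -- `h_3` and the sum of squares `p₂` are those of `x, y, s`
  have hxy0 : x + y = 0 := by
    have h1 := hmin.lagrange (k := 3) hx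
    have h2 := hmin.lagrange_pair (k := 2) hx hy hxy
    have h3 := hCoeff_succ_cons 2 y (x ::ₘ s)
    rw [Multiset.cons_swap] at h3
    have h4 := three_mul_hCoeff_three hsum
    have h5 := two_mul_hCoeff_two (x ::ₘ y ::ₘ s)
    rw [hsum] at h5
    rw [hcube] at h4
    push_cast at h1 h2
    have hb : 0 < sqSum (x ::ₘ y ::ₘ s) := by
      rw [sqSum_cons, sqSum_cons]; positivity
    have h6 : sqSum s * ((x + y) * sqSum (x ::ₘ y ::ₘ s)) = 0 := by
      linear_combination 2 * sqSum s * h4 - 6 * sqSum s * h3 - 6 * h1 + 6 * x * h2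
        - 3 * (x + y) * sqSum s * h5
    have h7 := (mul_eq_zero.1 h6).resolve_left hpos.ne'
    exact (mul_eq_zero.1 h7).resolve_right hb.ne'
  have hx2 : x ^ 2 = sqSum s / (2 * N) := by
    have hy' : y = -x := by linarith
    rw [hy'] at hw
    rw [eq_div_iff (by positivity)]
    rw [eq_div_iff hN'.ne'] at hw
    linarith
  have hy2 : y ^ 2 = sqSum s / (2 * N) := by
    rw [← hx2, show y = -x by linarith, neg_sq]
  refine ⟨fun v hv => ?_, ?_⟩
  · have hle : ∀ b ∈ s, b ^ 2 ≤ sqSum s / (2 * N) := by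
      intro b hb
      by_cases h1 : b = x
      · rw [h1, hx2]
      by_cases h2 : b = y
      · rw [h2, hy2]
      rw [hthird b hb h1 h2, zero_pow two_ne_zero]
      positivity
    -- a single square below the mean square would make the sum of squares too small
    refine le_antisymm (hle v hv) ?_
    obtain ⟨t, rfl⟩ := Multiset.exists_cons_of_mem hv
    have h1 := sqSum_le_card_mul (t := t) fun b hb => hle b (Multiset.mem_cons_of_mem hb)
    have h2 : (t.card : ℝ) + 1 = 2 * N := by
      have := hs
      rw [Multiset.card_cons] at this
      exact_mod_cast this
    have h3 : 2 * N * (sqSum (v ::ₘ t) / (2 * N)) = sqSum (v ::ₘ t) := by field_simp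
    rw [← h2] at h3
    have h4 := sqSum_cons v t
    rw [h2] at h3
    have h5 : (t.card : ℝ) = 2 * N - 1 := by linarith
    rw [h5] at h1
    linarith
  · simp only [Multiset.sum_cons] at hsum
    linarith

theorem balanced_of_hCoeff_eq (r : ℕ) (hr : 2 ≤ r) : ∀ (N : ℕ) (s : Multiset ℝ), 0 < N →
    s.card = 2 * N → 0 < sqSum s →
      hCoeff (2 * r) s = negBinomCoeff N r * (sqSum s / (2 * N)) ^ r →
        (∀ v ∈ s, v ^ 2 = sqSum s / (2 * N)) ∧ s.sum = 0 := by
  induction r, hr using Nat.le_induction with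
  | base => exact fun N s hN hs hpos heq => balanced_of_hCoeff_four_eq hN hs hpos heq
  | succ r hr ih =>
    intro N s hN hs hpos heq
    have hN' : (0 : ℝ) < N := Nat.cast_pos.2 hN
    obtain ⟨x, hx, y, hy, hxy, hw, hM⟩ :=
      exists_pair_of_hCoeff_eq (by omega) hN hs hpos heq
    obtain ⟨h1, h2⟩ := ih (N + 1) (x ::ₘ y ::ₘ s) (by omega) (by simp [hs]; ring)
      (by rw [sqSum_cons, sqSum_cons]; positivity) hM
    have hq : sqSum (x ::ₘ y ::ₘ s) / (2 * ((N + 1 : ℕ) : ℝ)) = sqSum s / (2 * N) := by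
      rw [sqSum_cons, sqSum_cons, ← add_assoc, hw]
      push_cast
      field_simp
      ring
    rw [hq] at h1
    refine ⟨fun v hv => h1 v (by simp [hv]), ?_⟩
    have hx2 := h1 x (by simp)
    have hy2 := h1 y (by simp)
    have h3 : x + y = 0 := by
      rcases sq_eq_sq_iff_eq_or_eq_neg.1 (hx2.trans hy2.symm) with h | h
      · exact absurd h hxy
      · linarith
    simp only [Multiset.sum_cons] at h2
    linarith

/-! ### Permutations of the half vector -/

/-- A multiset of even size whose elements are all `±x` and sum up to zero is balanced. -/
lemma eq_balanced {N : ℕ} {s : Multiset ℝ} {x : ℝ} (hx : x ≠ 0) (hs : s.card = 2 * N)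
    (hsq : ∀ v ∈ s, v ^ 2 = x ^ 2) (hsum : s.sum = 0) :
    s = Multiset.replicate N x + Multiset.replicate N (-x) := by
  classical
  have hne : ∀ v ∈ s.filter (· ≠ x), v = -x := fun v hv => by
    obtain ⟨hv, hvx⟩ := Multiset.mem_filter.1 hv
    exact (sq_eq_sq_iff_eq_or_eq_neg.1 (hsq v hv)).resolve_left hvx
  obtain ⟨k, l, rfl⟩ : ∃ k l, s = Multiset.replicate k x + Multiset.replicate l (-x) := by
    refine ⟨s.count x, (s.filter (· ≠ x)).card, ?_⟩
    rw [← Multiset.eq_replicate_card.2 hne, ← Multiset.filter_eq']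
    exact (Multiset.filter_add_not _ s).symm
  simp only [Multiset.sum_add, Multiset.sum_replicate, nsmul_eq_mul, Multiset.card_add,
    Multiset.card_replicate] at hsum hs
  have h : (k : ℝ) = l := mul_right_cancel₀ hx (by linarith)
  have h' : k = l := by exact_mod_cast h
  obtain rfl : k = N := by omega
  rw [← h']

lemma isPermutationOf_iff_map_eq {n : ℕ} {a b : Fin n → ℝ} :
    IsPermutationOf a b ↔ Finset.univ.val.map a = Finset.univ.val.map b := by
  classical
  constructor
  · rintro ⟨σ, hσ⟩
    rw [show a = b ∘ σ from funext hσ, ← Multiset.map_map, Multiset.map_univ_val_equiv]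
  · intro h
    have hcard (c : ℝ) : Fintype.card {i // a i = c} = Fintype.card {i // b i = c} := by
      have := congrArg (Multiset.count c) h
      rw [Multiset.count_map, Multiset.count_map] at this
      rw [Fintype.card_subtype, Fintype.card_subtype]
      simpa [Finset.card, eq_comm] using this
    refine ⟨Equiv.ofFiberEquiv fun c => Fintype.equivOfCardEq (hcard c), fun i => ?_⟩
    exact (Equiv.ofFiberEquiv_map _ i).symm

lemma halfVector_sq {n : ℕ} (i : Fin n) : halfVector n i ^ 2 = (1 / √(n : ℝ)) ^ 2 := by
  rw [halfVector]
  split_ifs <;> ring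

lemma sum_halfVector {n : ℕ} (hn : Even n) : ∑ i, halfVector n i = 0 := by
  obtain ⟨N, rfl⟩ := hn
  have h : (N + N) / 2 = N := by omega
  rw [Fin.sum_univ_add]
  simp [halfVector, h]

lemma hunterBound_two_mul {N : ℕ} (hN : 0 < N) (r : ℕ) :
    hunterBound (2 * N) r = negBinomCoeff N r * (1 / (2 * N)) ^ r := by
  have h := Nat.factorial_mul_ascFactorial' N r hN
  have h' : ((N - 1).factorial : ℝ) * N.ascFactorial r = (N + r - 1).factorial := by
    exact_mod_cast h
  have h0 : ((N - 1).factorial : ℝ) ≠ 0 := Nat.cast_ne_zero.2 (Nat.factorial_ne_zero _)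
  have h1 : (r.factorial : ℝ) ≠ 0 := Nat.cast_ne_zero.2 (Nat.factorial_ne_zero _)
  rw [hunterBound, negBinomCoeff, Nat.mul_div_cancel_left N two_pos, ← h']
  push_cast
  rw [div_pow, one_pow]
  field_simp

theorem mainTheorem1 (n : ℕ) (hn : Even n) (hpos : 0 < n) (r : ℕ) (hr : 1 ≤ r) :
    (∑ i, halfVector n i ^ 2 = 1 ∧
      completeHomogeneous (2 * r) (halfVector n) = hunterBound n r) ∧
    ∀ a : Fin n → ℝ, ∑ i, a i ^ 2 = 1 →
      hunterBound n r ≤ completeHomogeneous (2 * r) a ∧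
      (IsPermutationOf a (halfVector n) →
        completeHomogeneous (2 * r) a = hunterBound n r) ∧
      (2 ≤ r ∨ n = 2 →
        (completeHomogeneous (2 * r) a = hunterBound n r ↔
          IsPermutationOf a (halfVector n))) ∧
      (r = 1 →
        (completeHomogeneous (2 * r) a = hunterBound n r ↔ ∑ i, a i = 0)) := by
  obtain ⟨N, rfl⟩ : ∃ N, n = 2 * N := hn.exists_two_nsmul.imp fun N h => by simpa using h
  have hN : 0 < N := by omega
  have hN' : (0 : ℝ) < N := Nat.cast_pos.2 hN
  have hx2 : (1 / √((2 * N : ℕ) : ℝ)) ^ 2 = 1 / (2 * N) := by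
    rw [div_pow, one_pow, Real.sq_sqrt (Nat.cast_nonneg _)]
    push_cast
    rfl
  have hx0 : 1 / √((2 * N : ℕ) : ℝ) ≠ 0 := by
    rw [← pow_ne_zero_iff two_ne_zero, hx2]
    positivity
  set x : ℝ := 1 / √((2 * N : ℕ) : ℝ) with hx
  -- the permutations of the half vector, in terms of power sums
  have hbal (a : Fin (2 * N) → ℝ) (h1 : ∀ i, a i ^ 2 = x ^ 2) (h2 : ∑ i, a i = 0) :
      Finset.univ.val.map a = Multiset.replicate N x + Multiset.replicate N (-x) :=
    eq_balanced hx0 (by simp) (fun v hv => by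
      obtain ⟨i, _, rfl⟩ := Multiset.mem_map.1 hv
      exact h1 i) h2
  have hhalf := hbal (halfVector (2 * N)) halfVector_sq (sum_halfVector hn)
  have hperm (a : Fin (2 * N) → ℝ) (h1 : ∀ i, a i ^ 2 = x ^ 2) (h2 : ∑ i, a i = 0) :
      IsPermutationOf a (halfVector (2 * N)) :=
    isPermutationOf_iff_map_eq.2 ((hbal a h1 h2).trans hhalf.symm)
  have heq (a : Fin (2 * N) → ℝ) (ha : IsPermutationOf a (halfVector (2 * N))) :
      completeHomogeneous (2 * r) a = hunterBound (2 * N) r := by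
    rw [completeHomogeneous_eq_hCoeff, isPermutationOf_iff_map_eq.1 ha, hhalf, hCoeff_balanced,
      hunterBound_two_mul hN, hx2]
  refine ⟨⟨?_, heq _ ⟨1, fun i => rfl⟩⟩, fun a ha => ?_⟩
  · simp only [halfVector_sq]
    rw [← hx, hx2]
    simp
    field_simp
  have hsq : sqSum (Finset.univ.val.map a) = 1 := by
    rw [sqSum, Multiset.map_map]
    exact ha
  have hone : r = 1 → (completeHomogeneous (2 * r) a = hunterBound (2 * N) r ↔ ∑ i, a i = 0) := by
    rintro rfl
    have h2 := two_mul_hCoeff_two (Finset.univ.val.map a)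
    rw [hsq, ← completeHomogeneous_eq_hCoeff] at h2
    change 2 * completeHomogeneous 2 a = (∑ i, a i) ^ 2 + 1 at h2
    have hb : hunterBound (2 * N) 1 = 1 / 2 := by
      rw [hunterBound_two_mul hN]
      simp [negBinomCoeff, Nat.ascFactorial_succ]
      field_simp
    rw [mul_one, hb, ← pow_eq_zero_iff two_ne_zero]
    constructor <;> intro h <;> linarith
  refine ⟨?_, heq a, fun hcase => ⟨fun h => ?_, heq a⟩, hone⟩
  · have := negBinomCoeff_mul_pow_le_hCoeff r N (Finset.univ.val.map a) hN (by simp)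
      (by rw [hsq]; exact one_pos)
    rwa [hsq, ← hunterBound_two_mul hN, ← completeHomogeneous_eq_hCoeff] at this
  · by_cases hr2 : 2 ≤ r
    · rw [completeHomogeneous_eq_hCoeff, hunterBound_two_mul hN, ← hsq] at h
      obtain ⟨h1, h2⟩ := balanced_of_hCoeff_eq r hr2 N (Finset.univ.val.map a) hN (by simp)
        (by rw [hsq]; exact one_pos) h
      refine hperm a (fun i => ?_) h2
      rw [h1 (a i) (Multiset.mem_map_of_mem a (Finset.mem_univ_val i)), hsq, hx2]
    · have hr1 : r = 1 := by omega
      obtain rfl : N = 1 := by omega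
      have h0 := (hone hr1).1 h
      refine hperm a (fun i => ?_) h0
      simp only [Nat.reduceMul, Fin.sum_univ_two] at ha h0
      have hsame : a 0 ^ 2 = a 1 ^ 2 := by linear_combination (a 0 - a 1) * h0
      rw [hx2, Nat.cast_one, mul_one, eq_div_iff two_ne_zero]
      fin_cases i
      · change a 0 ^ 2 * 2 = 1
        linarith
      · change a 1 ^ 2 * 2 = 1
        linarith
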